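/- **Theorem (Izeki–Nayatani).** Let $Z$ be a finite simplicial complex with fundamental group $\Gamma$, equipped with a weight, i.e. a function $m>0$ on the simplices such that $m(\sigma)=\sum_{\tau} m(\tau)$ for every non-maximal $k$-simplex $\sigma$ ($k\ge 0$), the sum being over the $(k+1)$-simplices $\tau\supset\sigma$. For a vertex $z$, the link $\mathrm{link}(z)$ is the complex of the simplices $\sigma$ with $z\notin\sigma$ such that $\{z\}\cup\sigma$ is a simplex of $Z$; it is given the weight $\sigma\mapsto m(\{z\}\cup\sigma)$. Let $Y$ be a non-empty complete geodesic CAT(0) metric space. For a finite complex $C$ with a weight $m$, with vertex set $C^0$ and edge set $C^1$, and a map $g:C^0\to Y$, put $$E(g)=\sum_{\{c,c'\}\in C^1} m(c,c')\,d(g(c),g(c'))^2,\qquad d(g,y)^2=\sum_{c\in C^0} m(c)\,d(g(c),y)^2\quad (y\in Y),$$ and let $\mathrm{bar}(g)$ be the unique point of $Y$ at which $y\mapsto d(g,y)^2$ is minimal. Define $$\lambda(C,Y)=\inf\Big\{\frac{E(g)}{d(g,\mathrm{bar}(g))^2}\ :\ g:C^0\to Y \text{ non-constant}\Big\}\in[0,+\infty]$$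 (with $\inf\emptyset=+\infty$). If $\lambda(\mathrm{link}(z),Y)>\tfrac12$ for every vertex $z$ of $Z$, then every action of $\Gamma$ on $Y$ by isometries has a fixed point. -/

import Mathlib

noncomputable section

/-! ### Geodesic metric spaces and the CAT(0) condition -/

/-- `γ`, restricted to `[0, dist x y]`, is a geodesic segment of unit speed from `x` to `y`. -/
structure IsGeodesicSegment {Y : Type*} [MetricSpace Y] (γ : ℝ → Y) (x y : Y) : Prop where
  source : γ 0 = x
  target : γ (dist x y) = y
  isometric : ∀ s ∈ Set.Icc 0 (dist x y), ∀ t ∈ Set.Icc 0 (dist x y),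
    dist (γ s) (γ t) = |s - t|

/-- Any two points of `Y` are joined by a geodesic segment. -/
def IsGeodesicSpace (Y : Type*) [MetricSpace Y] : Prop :=
  ∀ x y : Y, ∃ γ : ℝ → Y, IsGeodesicSegment γ x y

/-- The CAT(0) comparison inequality. For every geodesic segment `γ` from `x` to `y`, every point
`p` and every triangle `p' x' y'` of the Euclidean plane with the same side lengths, the distance
from `p` to a point of `γ` is at most the distance from `p'` to the point which divides
`[x', y']` in the same proportions. -/
def IsCAT0 (Y : Type*) [MetricSpace Y] : Prop :=
  ∀ (p x y : Y) (γ : ℝ → Y), IsGeodesicSegment γ x y →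
    ∀ p' x' y' : EuclideanSpace ℝ (Fin 2),
      dist p' x' = dist p x → dist p' y' = dist p y → dist x' y' = dist x y →
        ∀ t ∈ Set.Icc 0 (dist x y),
          dist p (γ t) ≤ dist p' (AffineMap.lineMap x' y' (t / dist x y))

/-! ### Finite simplicial complexes -/

namespace PreAbstractSimplicialComplex

variable {V : Type*}

/-- The set of vertices of a simplicial complex. -/
def vertices (C : PreAbstractSimplicialComplex V) : Set V :=
  {v | ({v} : Finset V) ∈ C.faces}

open Classical in
/-- The geometric realization of a complex with finitely many vertices, in barycentric
coordinates, as a subspace of `ℝ^V`. -/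
def realization [Fintype V] (C : PreAbstractSimplicialComplex V) : Set (V → ℝ) :=
  {t | t ∈ stdSimplex ℝ V ∧ Finset.univ.filter (fun v => t v ≠ 0) ∈ C.faces}

open Classical in
/-- The link of `z`: the simplices `σ` which do not contain `z` and such that `{z} ∪ σ` is a
simplex. -/
def link (C : PreAbstractSimplicialComplex V) (z : V) : PreAbstractSimplicialComplex V where
  faces := {s | s.Nonempty ∧ z ∉ s ∧ insert z s ∈ C.faces}
  isRelLowerSet_faces := by
    rintro s ⟨hs, hz, hf⟩
    refine ⟨hs, fun t hts ht => ⟨ht, fun h => hz (hts h), ?_⟩⟩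
    exact (C.isRelLowerSet_faces hf).2 (Finset.insert_subset_insert z hts)
      (Finset.insert_nonempty z t)

open Classical in
/-- A weight: a positive function `m` on the simplices such that the weight of every
`k`-simplex which is not a maximal simplex is the sum of the weights of the `(k+1)`-simplices
which contain it. -/
structure IsWeight [Fintype V] (C : PreAbstractSimplicialComplex V) (m : Finset V → ℝ) :
    Prop where
  pos : ∀ s ∈ C.faces, 0 < m s
  eq_sum : ∀ s ∈ C.faces, (∃ t ∈ C.faces, s ⊂ t) →
    m s = ∑ t ∈ Finset.univ.filter (fun t => t ∈ C.faces ∧ s ⊆ t ∧ t.card = s.card + 1), m t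

open Classical in
/-- The weight induced on the link of `z` by a weight `m`. -/
def linkWeight (m : Finset V → ℝ) (z : V) : Finset V → ℝ :=
  fun s => m (insert z s)

/-! ### Energy, barycenter, Rayleigh quotient and bottom of the spectrum -/

section Spectrum

variable {Y : Type*} [MetricSpace Y]

open Classical in
/-- The weighted product distance between two maps from the vertices of `C` to `Y`. -/
def weightedDist [Fintype V] (C : PreAbstractSimplicialComplex V) (m : Finset V → ℝ)
    (g g' : C.vertices → Y) : ℝ :=
  Real.sqrt (∑ c : C.vertices, m {(c : V)} * dist (g c) (g' c) ^ 2)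

open Classical in
/-- The energy of a map from the vertices of `C` to `Y`: the sum over the (unoriented) edges of
`m(e)` times the squared distance of the images of the end points, written as half of the sum
over the ordered pairs of adjacent vertices. -/
def energy [Fintype V] (C : PreAbstractSimplicialComplex V) (m : Finset V → ℝ)
    (g : C.vertices → Y) : ℝ :=
  (1 / 2) * ∑ c : C.vertices, ∑ c' : C.vertices,
    if c ≠ c' ∧ ({(c : V), (c' : V)} : Finset V) ∈ C.faces then
      m {(c : V), (c' : V)} * dist (g c) (g c') ^ 2 else 0

/-- `b` is a barycenter of `g`: it minimizes `y ↦ d(g, y)²`. -/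
def IsBarycenter [Fintype V] (C : PreAbstractSimplicialComplex V) (m : Finset V → ℝ)
    (g : C.vertices → Y) (b : Y) : Prop :=
  ∀ y : Y, C.weightedDist m g (fun _ => b) ^ 2 ≤ C.weightedDist m g (fun _ => y) ^ 2

/-- The quotient `E(g) / d(g, b)²`; it is the Rayleigh quotient of `g` when `b` is the
barycenter of `g`. -/
def rayleighQuotient [Fintype V] (C : PreAbstractSimplicialComplex V) (m : Finset V → ℝ)
    (g : C.vertices → Y) (b : Y) : ℝ :=
  C.energy m g / C.weightedDist m g (fun _ => b) ^ 2

/-- The bottom of the spectrum `λ(C, m, Y)`: the infimum of the Rayleigh quotients of the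
non-constant maps from the vertices of `C` to `Y`, which is `⊤` when there is no such map. In a
complete geodesic CAT(0) space every map has exactly one barycenter `b`. -/
def bottomSpectrum [Fintype V] (C : PreAbstractSimplicialComplex V) (m : Finset V → ℝ)
    (Y : Type*) [MetricSpace Y] : EReal :=
  ⨅ (g : C.vertices → Y) (b : Y) (_ : ¬ ∃ y : Y, ∀ c, g c = y) (_ : C.IsBarycenter m g b),
    ((C.rayleighQuotient m g b : ℝ) : EReal)

end Spectrum

end PreAbstractSimplicialComplex

end

/-!
An action of `Γ = π₁(|Z|)` on `Y` twists the maps `f` from the vertices of `Z` to `Y`: transport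
along the edges gives isometries `φ v w` that compose over the simplices (`IsCocycle`), and the
twisted maps stand for the equivariant maps on the universal cover. A fixed point is the same as a
twisted map of energy zero, one with `f v = φ v w (f w)` on every edge. Such a map is found by a
discrete descent, which needs no harmonic maps.

*The estimate.* Write `D(f, g) = ∑ m(x, c) d(f(x), φ x c (g(c)))²` for the sum over ordered pairs
of adjacent vertices, and `Q(f) = D(f, f)`, twice the energy. The energies of `f` on the links of
the vertices add up to at most `Q(f) / 2`, because the triangles over an edge weigh at most as
much as the edge (`sum_energy_link_le`). Hence, if `g(x)` is the barycenter of `f` on the link of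
`x` and all spectra are at least `l > 1 / 2`, then `l D(g, f) ≤ Q(f) / 2`, that is,
`D(g, f) ≤ θ Q(f)` with `θ = 1 / (2 l) < 1` (`exists_twistedEnergy_le`).

*The descent.* Move each `f(x)` by a proportion `t` towards `g(x)`, to `h(x)`. Convexity of the
squared distance in both variables and `Q(g) ≤ 9 Q(f)` give
`Q(h) ≤ ((1 - t)² + 2 t (1 - t) θ + 9 t²) Q(f)`, and for small `t` the factor is less than `1`. The
displacement `d(f(x), h(x))²` is at most a constant times `Q(f)`
(`exists_twistedEnergy_contraction`). The iterates therefore converge at a geometric rate, and the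
limit has energy zero (`exists_flat_of_link_spectrum`).

*The topology.* The action is encoded as a functor from the fundamental groupoid of the realization
to the isometries of `Y` (`PathTransport`). A flat map on the vertices extends along straight
segments to a section over the whole realization. Open stars are star-convex, so the section is
preserved by the transport along a path in an open star, and, after subdivision, along every path
(`exists_parallel_section`). For loops at `x₀` this says that its value at `x₀` is fixed.
-/

/-! ### Transport along paths -/

/-- A transport on `X` with values in a group `G`: a homotopy invariant and multiplicative
assignment of an element of `G` to every path, that is, a functor from the fundamental groupoid
of `X` to `G`. -/
structure PathTransport (X G : Type*) [TopologicalSpace X] [Group G] where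
  /-- The element of the group attached to a path. -/
  along : ∀ {a b : X}, Path a b → G
  along_eq_of_homotopic : ∀ {a b : X} {p q : Path a b}, p.Homotopic q → along p = along q
  along_trans : ∀ {a b c : X} (p : Path a b) (q : Path b c),
    along (p.trans q) = along p * along q

namespace PathTransport

open unitInterval

variable {X G : Type*} [TopologicalSpace X] [Group G]

/-- A homomorphism from a fundamental group extends to a transport: join the base point `x₀` to
every point of its path component, and close up the paths of that component to loops.
In Mathlib's fundamental group the product `γ * δ` runs through `δ` first, so the
transport is built from the inverses. -/
theorem exists_of_fundamentalGroup (x₀ : X) (ψ : FundamentalGroup X x₀ →* G) :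
    ∃ Φ : PathTransport X G, ∀ γ, ∃ p : Path x₀ x₀, Φ.along p = ψ γ := by
  classical
  let w : ∀ a : X, Joined x₀ a → Path.Homotopic.Quotient x₀ a := fun a h => ⟦h.somePath⟧
  let loop : ∀ {a b : X} (h : Joined x₀ a), Path a b → Path.Homotopic.Quotient x₀ x₀ :=
    fun {a b} h p => ((w a h).trans ⟦p⟧).trans (w b (h.trans ⟨p⟩)).symm
  let Φ : PathTransport X G :=
    { along := fun {a b} p => if h : Joined x₀ a then
        (ψ (FundamentalGroup.fromPath (loop h p)))⁻¹ else 1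
      along_eq_of_homotopic := by
        intro a b p q hpq
        have : (⟦p⟧ : Path.Homotopic.Quotient a b) = ⟦q⟧ := Quotient.sound hpq
        simp only [loop, this]
      along_trans := by
        intro a b c p q
        by_cases h : Joined x₀ a
        · have hb : Joined x₀ b := h.trans ⟨p⟩
          have key : loop h (p.trans q) = (loop h p).trans (loop hb q) := by
            have : (⟦p.trans q⟧ : Path.Homotopic.Quotient a c) =
              Path.Homotopic.Quotient.trans ⟦p⟧ ⟦q⟧ := rfl
            simp only [loop, this]
            grind
          simp only [dif_pos h, dif_pos hb, key]
          rw [← mul_inv_rev, ← map_mul]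
          rfl
        · have hb : ¬ Joined x₀ b := fun hb => h (hb.trans ⟨p.symm⟩)
          simp only [dif_neg h, dif_neg hb, mul_one] }
  refine ⟨Φ, fun γ => ?_⟩
  have h : Joined x₀ x₀ := Joined.refl x₀
  obtain ⟨p, hp⟩ := Quotient.exists_rep
    (((w x₀ h).symm.trans (FundamentalGroup.toPath γ⁻¹)).trans (w x₀ h))
  refine ⟨p, ?_⟩
  have key : loop h p = FundamentalGroup.toPath γ⁻¹ := by
    simp only [loop]
    rw [hp]
    grind
  have : Φ.along p = (ψ (FundamentalGroup.fromPath (loop h p)))⁻¹ := dif_pos h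
  rw [this, key]
  change (ψ γ⁻¹)⁻¹ = ψ γ
  rw [map_inv, inv_inv]

/-- The transport along a constant path is trivial. -/
theorem along_refl (Φ : PathTransport X G) (a : X) : Φ.along (Path.refl a) = 1 := by
  have h := Φ.along_trans (Path.refl a) (Path.refl a)
  rw [Path.refl_trans_refl] at h
  exact left_eq_mul.mp h

/-- A section which is preserved by the transport along all short paths is preserved by the
transport along every path. -/
theorem along_apply_eq_of_locally {Y : Type*} [MetricSpace Y] (Φ : PathTransport X (Y ≃ᵢ Y))
    {ι : Type*} (U : ι → Set X) (hU : ∀ i, IsOpen (U i)) (hcov : ∀ x, ∃ i, x ∈ U i)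
    (F : X → Y)
    (hF : ∀ i {a b : X} (p : Path a b), (∀ t, p t ∈ U i) → Φ.along p (F b) = F a)
    {a b : X} (p : Path a b) : Φ.along p (F b) = F a := by
  obtain ⟨t, ht0, hmono, ⟨N, hN⟩, hsub⟩ :=
    exists_monotone_Icc_subset_open_cover_unitInterval (c := fun i => p ⁻¹' U i)
      (fun i => (hU i).preimage p.continuous)
      (fun s _ => by
        obtain ⟨i, hi⟩ := hcov (p s)
        exact Set.mem_iUnion.mpr ⟨i, hi⟩)
  have key : ∀ n, Φ.along (p.subpath 0 (t n)) (F (p (t n))) = F (p 0) := by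
    intro n
    induction n with
    | zero => rw [ht0, Path.subpath_self, along_refl]; rfl
    | succ n ih =>
      obtain ⟨i, hi⟩ := hsub n
      rw [← Φ.along_eq_of_homotopic ⟨Path.Homotopy.subpathTransSubpath p 0 (t n) (t (n + 1))⟩,
        Φ.along_trans, IsometryEquiv.mul_apply, hF i (p.subpath (t n) (t (n + 1))), ih]
      intro s
      have hs : p.subpath (t n) (t (n + 1)) s ∈ p '' Set.Icc (t n) (t (n + 1)) := by
        rw [← Path.range_subpath_of_le p _ _ (hmono n.le_succ)]
        exact Set.mem_range_self s
      obtain ⟨u, hu, hus⟩ := hs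
      rw [← hus]
      exact hi hu
  have h1 := key N
  rw [hN N le_rfl] at h1
  have h2 : ∀ {a' b' : X} (ha : a' = a) (hb : b' = b),
      Φ.along (p.cast ha hb) (F b') = F a' → Φ.along p (F b) = F a := by
    rintro _ _ rfl rfl h
    exact h
  exact h2 p.source p.target (by rw [← Path.subpath_zero_one]; exact h1)

end PathTransport

/-! ### Transport along straight segments -/

/-- Two paths with the same end points in a simply connected part `T` of `R` are homotopic
in `R`. -/
theorem Path.homotopic_of_mem_simplyConnected {E : Type*} [TopologicalSpace E] {R T : Set E}
    (hTR : T ⊆ R) (hT : SimplyConnectedSpace T) {a b : R} (p q : Path a b)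
    (hp : ∀ t, (p t : E) ∈ T) (hq : ∀ t, (q t : E) ∈ T) : p.Homotopic q := by
  have ha : (a : E) ∈ T := by simpa using hp 0
  have hb : (b : E) ∈ T := by simpa using hp 1
  let lift : ∀ r : Path a b, (∀ t, (r t : E) ∈ T) → Path (⟨a, ha⟩ : T) ⟨b, hb⟩ := fun r hr =>
    { toFun := fun t => ⟨r t, hr t⟩
      continuous_toFun := by fun_prop
      source' := by simp
      target' := by simp }
  have h := (SimplyConnectedSpace.paths_homotopic (lift p hp) (lift q hq)).map
    ⟨Set.inclusion hTR, continuous_inclusion hTR⟩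
  exact h

section Segment

variable {E G : Type*} [AddCommGroup E] [Module ℝ E] [TopologicalSpace E] [IsTopologicalAddGroup E]
  [ContinuousSMul ℝ E] [Group G] {R : Set E}

/-- The straight path between two points of `R` whose segment lies in `R`. -/
def Path.straight (a b : E) (h : segment ℝ a b ⊆ R) :
    Path (⟨a, h (left_mem_segment ℝ a b)⟩ : R) ⟨b, h (right_mem_segment ℝ a b)⟩ where
  toFun t := ⟨AffineMap.lineMap a b (t : ℝ), h (by
    rw [segment_eq_image_lineMap]
    exact Set.mem_image_of_mem _ t.2)⟩
  continuous_toFun := by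
    simp only [AffineMap.lineMap_apply_module]
    fun_prop
  source' := by simp
  target' := by simp

theorem Path.straight_mem {a b : E} (h : segment ℝ a b ⊆ R) (t : unitInterval) :
    (Path.straight a b h t : E) ∈ segment ℝ a b := by
  rw [segment_eq_image_lineMap]
  exact Set.mem_image_of_mem _ t.2

namespace PathTransport

variable (Φ : PathTransport R G)

open Classical in
/-- The transport along the straight segment from `a` to `b`; it is set to `1` if the segment is
not contained in `R`. -/
noncomputable def alongSegment (a b : E) : G :=
  if h : segment ℝ a b ⊆ R then Φ.along (Path.straight a b h) else 1

/-- In a star-convex part of `R` every path has the same transport as the path made of the two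
segments through the centre. -/
theorem along_eq_of_starConvex {T : Set E} (hTR : T ⊆ R) {v : E} (hv : v ∈ T)
    (hT : StarConvex ℝ v T) {a b : R} (p : Path a b) (hp : ∀ t, (p t : E) ∈ T) :
    Φ.along p = Φ.alongSegment a v * Φ.alongSegment v b := by
  have ha : segment ℝ (a : E) v ⊆ T := by
    rw [segment_symm]
    exact hT.segment_subset (by simpa using hp 0)
  have hb : segment ℝ v (b : E) ⊆ T := hT.segment_subset (by simpa using hp 1)
  have := hT.contractibleSpace ⟨v, hv⟩
  rw [alongSegment, alongSegment, dif_pos (ha.trans hTR), dif_pos (hb.trans hTR),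
    ← Φ.along_trans]
  refine Φ.along_eq_of_homotopic
    (Path.homotopic_of_mem_simplyConnected hTR inferInstance _ _ hp fun t => ?_)
  have ht := Set.mem_range_self (f := (Path.straight (a : E) v (ha.trans hTR)).trans
    (Path.straight v b (hb.trans hTR))) t
  rw [Path.trans_range] at ht
  rcases ht with ⟨s, hs⟩ | ⟨s, hs⟩
  · rw [← hs]
    exact ha (Path.straight_mem _ s)
  · rw [← hs]
    exact hb (Path.straight_mem _ s)

/-- In a convex part of `R` the transport along segments is multiplicative. -/
theorem alongSegment_mul_alongSegment {T : Set E} (hTR : T ⊆ R) (hT : Convex ℝ T) {a b c : E}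
    (ha : a ∈ T) (hb : b ∈ T) (hc : c ∈ T) :
    Φ.alongSegment a b * Φ.alongSegment b c = Φ.alongSegment a c := by
  have hac : segment ℝ a c ⊆ T := hT.segment_subset ha hc
  have h := Φ.along_eq_of_starConvex hTR hb (hT.starConvex hb)
    (Path.straight a c (hac.trans hTR)) (fun t => hac (Path.straight_mem _ t))
  rw [← h, alongSegment, dif_pos (hac.trans hTR)]

end PathTransport

end Segment

/-! ### The realization of a complex -/

namespace PreAbstractSimplicialComplex

variable {V : Type*}

theorem mem_faces_of_subset (Z : PreAbstractSimplicialComplex V) {s t : Finset V}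
    (hs : s ∈ Z.faces) (hts : t ⊆ s) (ht : t.Nonempty) : t ∈ Z.faces :=
  (Z.isRelLowerSet_faces hs).2 hts ht

variable [Fintype V]

/-- The closed simplex spanned by `s`, in barycentric coordinates. -/
def closedSimplex (s : Finset V) : Set (V → ℝ) :=
  {t | t ∈ stdSimplex ℝ V ∧ ∀ v, t v ≠ 0 → v ∈ s}

theorem convex_closedSimplex (s : Finset V) : Convex ℝ (closedSimplex s) := by
  intro x hx y hy a b ha hb hab
  refine ⟨convex_stdSimplex ℝ V hx.1 hy.1 ha hb hab, fun v hv => ?_⟩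
  by_contra hvs
  have h1 : x v = 0 := by_contra fun h => hvs (hx.2 v h)
  have h2 : y v = 0 := by_contra fun h => hvs (hy.2 v h)
  exact hv (by simp [h1, h2])

theorem closedSimplex_subset_realization (Z : PreAbstractSimplicialComplex V) {s : Finset V}
    (hs : s ∈ Z.faces) : closedSimplex s ⊆ Z.realization := by
  classical
  intro t ht
  refine ⟨ht.1, Z.mem_faces_of_subset hs (fun v hv => ht.2 v (by simpa using hv)) ?_⟩
  by_contra hne
  have hz : ∀ v, t v = 0 := by simpa [Finset.filter_eq_empty_iff] using hne
  have := ht.1.2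
  simp [hz] at this

open Classical in
theorem single_mem_closedSimplex {s : Finset V} {v : V} (hv : v ∈ s) :
    (Pi.single v 1 : V → ℝ) ∈ closedSimplex s := by
  refine ⟨single_mem_stdSimplex ℝ v, fun w hw => ?_⟩
  by_cases h : w = v
  · rwa [h]
  · simp [h] at hw

/-- The open star of a vertex. -/
def openStar (Z : PreAbstractSimplicialComplex V) (v : V) : Set (V → ℝ) :=
  {t | t ∈ Z.realization ∧ 0 < t v}

open Classical in
theorem single_mem_realization (Z : PreAbstractSimplicialComplex V) {s : Finset V}
    (hs : s ∈ Z.faces) {v : V} (hv : v ∈ s) : (Pi.single v 1 : V → ℝ) ∈ Z.realization :=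
  Z.closedSimplex_subset_realization hs (single_mem_closedSimplex hv)

open Classical in
theorem starConvex_openStar (Z : PreAbstractSimplicialComplex V) (v : V) :
    StarConvex ℝ (Pi.single v 1 : V → ℝ) (Z.openStar v) := by
  intro t ht a b ha hb hab
  have hsupp : t ∈ closedSimplex (Finset.univ.filter fun w => t w ≠ 0) :=
    ⟨ht.1.1, fun w hw => by simpa using hw⟩
  refine ⟨Z.closedSimplex_subset_realization ht.1.2 (convex_closedSimplex _
    (single_mem_closedSimplex (by simpa using ht.2.ne')) hsupp ha hb hab), ?_⟩
  have htv := ht.2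
  have : (a • (Pi.single v 1 : V → ℝ) + b • t) v = a + b * t v := by simp
  rw [this]
  rcases ha.eq_or_lt with rfl | ha'
  · have : b = 1 := by linarith
    simpa [this] using htv
  · positivity

open Classical in
/-- A function on the vertices which is preserved by the transport along the edges extends to a
section over the whole realization which is preserved by the transport along every path. This
takes the place of the fact that every path between vertices is homotopic to an edge path. -/
theorem exists_parallel_section (Z : PreAbstractSimplicialComplex V) {Y : Type*} [MetricSpace Y]
    (Φ : PathTransport Z.realization (Y ≃ᵢ Y)) (f : V → Y)
    (hf : ∀ v w, ({v, w} : Finset V) ∈ Z.faces →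
      Φ.alongSegment (Pi.single v 1) (Pi.single w 1) (f w) = f v) :
    ∃ F : Z.realization → Y, ∀ {a b : Z.realization} (p : Path a b),
      Φ.along p (F b) = F a := by
  have hpos : ∀ a : Z.realization, ∃ v, 0 < (a : V → ℝ) v := by
    intro a
    obtain ⟨v, hv⟩ := (Z.isRelLowerSet_faces a.2.2).1
    exact ⟨v, lt_of_le_of_ne (a.2.1.1 v) (by simpa [eq_comm] using hv)⟩
  choose u hu using hpos
  have hsupp : ∀ a : Z.realization,
      (a : V → ℝ) ∈ closedSimplex (Finset.univ.filter fun w => (a : V → ℝ) w ≠ 0) :=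
    fun a => ⟨a.2.1, fun w hw => by simpa using hw⟩
  let F : Z.realization → Y := fun a => Φ.alongSegment (a : V → ℝ) (Pi.single (u a) 1) (f (u a))
  -- The value of `F` at `a` can be read off at any vertex of the simplex that carries `a`.
  have hF : ∀ (a : Z.realization) (v : V), 0 < (a : V → ℝ) v →
      F a = Φ.alongSegment (a : V → ℝ) (Pi.single v 1) (f v) := by
    intro a v hv
    have hmem : ∀ w, 0 < (a : V → ℝ) w →
        w ∈ Finset.univ.filter fun w => (a : V → ℝ) w ≠ 0 := fun w hw => by simpa using hw.ne'
    have he : ({u a, v} : Finset V) ∈ Z.faces := by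
      refine Z.mem_faces_of_subset a.2.2 ?_ (Finset.insert_nonempty _ _)
      intro w hw
      rcases Finset.mem_insert.mp hw with rfl | hw
      · exact hmem _ (hu a)
      · rw [Finset.mem_singleton.mp hw]; exact hmem _ hv
    rw [← Φ.alongSegment_mul_alongSegment (Z.closedSimplex_subset_realization a.2.2)
      (convex_closedSimplex _) (hsupp a) (single_mem_closedSimplex (hmem _ (hu a)))
      (single_mem_closedSimplex (hmem _ hv)), IsometryEquiv.mul_apply, hf _ _ he]
  refine ⟨F, fun {a b} p => Φ.along_apply_eq_of_locally
    (fun v => {a : Z.realization | 0 < (a : V → ℝ) v})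
    (fun v => isOpen_lt continuous_const ((continuous_apply v).comp continuous_subtype_val))
    (fun a => ⟨u a, hu a⟩) F ?_ p⟩
  intro v a b p hp
  have ha : 0 < (a : V → ℝ) v := by simpa using hp 0
  have hb : 0 < (b : V → ℝ) v := by simpa using hp 1
  have hv : v ∈ Finset.univ.filter fun w => (a : V → ℝ) w ≠ 0 := by simpa using ha.ne'
  have hvb : v ∈ Finset.univ.filter fun w => (b : V → ℝ) w ≠ 0 := by simpa using hb.ne'
  rw [Φ.along_eq_of_starConvex (T := Z.openStar v) (fun _ h => h.1)
      ⟨Z.single_mem_realization a.2.2 hv, by simp⟩ (Z.starConvex_openStar v) p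
      (fun t => ⟨(p t).2, hp t⟩), hF a v ha, hF b v hb, IsometryEquiv.mul_apply]
  congr 1
  rw [← IsometryEquiv.mul_apply, Φ.alongSegment_mul_alongSegment
    (Z.closedSimplex_subset_realization b.2.2) (convex_closedSimplex _)
    (single_mem_closedSimplex hvb) (hsupp b) (single_mem_closedSimplex hvb)]
  exact hf v v (Z.mem_faces_of_subset b.2.2 (by simpa using hb.ne') (Finset.insert_nonempty _ _))

end PreAbstractSimplicialComplex

/-! ### CAT(0) geometry -/

/-- Three numbers that satisfy the triangle inequalities are the side lengths of a triangle in the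
Euclidean plane. -/
theorem exists_comparison_triangle {a b c : ℝ} (ha : 0 ≤ a) (hb : 0 ≤ b) (hc : 0 ≤ c)
    (habc : a ≤ b + c) (hbac : b ≤ a + c) (hcab : c ≤ a + b) :
    ∃ p x y : EuclideanSpace ℝ (Fin 2), dist p x = a ∧ dist p y = b ∧ dist x y = c := by
  rcases hc.eq_or_lt with rfl | hc'
  · have : a = b := by linarith
    subst this
    refine ⟨!₂[a, 0], !₂[0, 0], !₂[0, 0], ?_, ?_, ?_⟩ <;>
      simp [EuclideanSpace.dist_eq, Fin.sum_univ_two, Real.dist_eq, ha]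
  · -- The apex over the base from `(0, 0)` to `(c, 0)`; the law of cosines gives its abscissa.
    set u : ℝ := (a ^ 2 + c ^ 2 - b ^ 2) / (2 * c) with hu
    have hcu : 2 * c * u = a ^ 2 + c ^ 2 - b ^ 2 := by rw [hu]; field_simp
    have h1 : 0 ≤ a - u := by
      have : 0 ≤ 2 * c * (a - u) := by nlinarith
      exact nonneg_of_mul_nonneg_right this (by positivity)
    have h2 : 0 ≤ a + u := by
      have : 0 ≤ 2 * c * (a + u) := by nlinarith
      exact nonneg_of_mul_nonneg_right this (by positivity)
    have hv : 0 ≤ a ^ 2 - u ^ 2 := by nlinarith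
    refine ⟨!₂[u, √(a ^ 2 - u ^ 2)], !₂[0, 0], !₂[c, 0], ?_, ?_, ?_⟩
    · simp [EuclideanSpace.dist_eq, Fin.sum_univ_two, Real.dist_eq, Real.sq_sqrt hv, ha]
    · simp only [EuclideanSpace.dist_eq, Fin.sum_univ_two, Real.dist_eq, sq_abs]
      rw [Real.sqrt_eq_iff_mul_self_eq (by positivity) hb]
      simp [Real.sq_sqrt hv]
      nlinarith
    · simp [EuclideanSpace.dist_eq, Fin.sum_univ_two, Real.dist_eq, Real.sqrt_sq hc]

/-- Stewart's theorem. -/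
theorem dist_lineMap_sq {E : Type*} [NormedAddCommGroup E] [InnerProductSpace ℝ E]
    (p x y : E) (s : ℝ) :
    dist p (AffineMap.lineMap x y s) ^ 2 =
      (1 - s) * dist p x ^ 2 + s * dist p y ^ 2 - s * (1 - s) * dist x y ^ 2 := by
  have h1 : p - AffineMap.lineMap x y s = (1 - s) • (p - x) + s • (p - y) := by
    rw [AffineMap.lineMap_apply_module]
    module
  have h2 : x - y = (p - y) - (p - x) := by abel
  rw [dist_eq_norm, dist_eq_norm, dist_eq_norm, dist_eq_norm, h1, h2, norm_add_sq_real,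
    norm_sub_sq_real (p - y) (p - x), norm_smul, norm_smul, inner_smul_left, inner_smul_right,
    real_inner_comm (p - x) (p - y), mul_pow, mul_pow, Real.norm_eq_abs, Real.norm_eq_abs,
    sq_abs, sq_abs]
  simp only [conj_trivial]
  ring

section CAT0

variable {Y : Type*} [MetricSpace Y]

/-- In a geodesic CAT(0) space, any two points are joined by a segment along which the square of
the distance to any fixed point is 2-strongly convex. -/
theorem IsCAT0.exists_point_dist_sq_le (hgeod : IsGeodesicSpace Y) (hcat : IsCAT0 Y) (x y : Y)
    {s : ℝ} (hs0 : 0 ≤ s) (hs1 : s ≤ 1) :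
    ∃ z : Y, ∀ p : Y, dist p z ^ 2 ≤
      (1 - s) * dist p x ^ 2 + s * dist p y ^ 2 - s * (1 - s) * dist x y ^ 2 := by
  obtain ⟨γ, hγ⟩ := hgeod x y
  rcases eq_or_ne x y with rfl | hxy
  · refine ⟨x, fun p => ?_⟩
    simp only [dist_self]
    linarith
  refine ⟨γ (s * dist x y), fun p => ?_⟩
  have hd : 0 < dist x y := dist_pos.mpr hxy
  obtain ⟨p', x', y', h1, h2, h3⟩ := exists_comparison_triangle (a := dist p x) (b := dist p y)
    (c := dist x y) dist_nonneg dist_nonneg dist_nonneg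
    (by have := dist_triangle p y x; rwa [dist_comm y x] at this) (dist_triangle p x y)
    (dist_triangle_left x y p)
  have h := hcat p x y γ hγ p' x' y' h1 h2 h3 (s * dist x y)
    ⟨by positivity, by nlinarith⟩
  rw [mul_div_assoc, div_self hd.ne', mul_one] at h
  calc dist p (γ (s * dist x y)) ^ 2 ≤ dist p' (AffineMap.lineMap x' y' s) ^ 2 := by gcongr
    _ = _ := by rw [dist_lineMap_sq, h1, h2, h3]

/-- A continuous function on a complete space that is bounded below and uniformly convex with
respect to approximate midpoints has a minimizer: minimizing sequences are Cauchy. -/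
theorem exists_forall_le_of_midpoint_convex [Nonempty Y] [CompleteSpace Y] {φ : Y → ℝ}
    (hφ : Continuous φ) (h0 : ∀ y, 0 ≤ φ y) {M : ℝ} (hM : 0 < M)
    (hmid : ∀ x y, ∃ z, φ z ≤ (φ x + φ y) / 2 - M * dist x y ^ 2) :
    ∃ b, ∀ y, φ b ≤ φ y := by
  have hbdd : BddBelow (Set.range φ) := ⟨0, by rintro _ ⟨y, rfl⟩; exact h0 y⟩
  set I := ⨅ y, φ y with hI
  have hle : ∀ y, I ≤ φ y := fun y => ciInf_le hbdd y
  have hex : ∀ n : ℕ, ∃ y, φ y < I + M * ((1 / 2) ^ n) ^ 2 := fun n =>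
    exists_lt_of_ciInf_lt (by rw [← hI]; have : 0 < M * ((1 / 2 : ℝ) ^ n) ^ 2 := by positivity
                              linarith)
  choose y hy using hex
  have hdist : ∀ n, dist (y n) (y (n + 1)) ≤ 1 * (1 / 2) ^ n := by
    intro n
    obtain ⟨z, hz⟩ := hmid (y n) (y (n + 1))
    have h1 := hle z
    have h2 := hy n
    have h3 := hy (n + 1)
    have h4 : M * ((1 / 2 : ℝ) ^ (n + 1)) ^ 2 ≤ M * ((1 / 2 : ℝ) ^ n) ^ 2 := by
      gcongr ?_ * ?_ ^ 2
      exact pow_le_pow_of_le_one (by norm_num) (by norm_num) n.le_succ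
    have h5 : M * dist (y n) (y (n + 1)) ^ 2 ≤ M * ((1 / 2 : ℝ) ^ n) ^ 2 := by linarith
    rw [one_mul]
    exact le_of_sq_le_sq (le_of_mul_le_mul_left h5 hM) (by positivity)
  obtain ⟨b, hb⟩ := cauchySeq_tendsto_of_complete
    (cauchySeq_of_le_geometric (1 / 2) 1 (by norm_num) hdist)
  refine ⟨b, fun x => le_trans (le_of_tendsto_of_tendsto' ((hφ.tendsto b).comp hb) ?_
    (fun n => (hy n).le)) (hle x)⟩
  have : Filter.Tendsto (fun n : ℕ => I + M * ((1 / 2 : ℝ) ^ n) ^ 2) Filter.atTop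
      (nhds (I + M * 0 ^ 2)) :=
    ((((tendsto_pow_atTop_nhds_zero_of_lt_one (by norm_num) (by norm_num)).pow 2).const_mul M)
      ).const_add I
  simpa using this

end CAT0

namespace PreAbstractSimplicialComplex

variable {V Y : Type*} [Fintype V] [MetricSpace Y]

open Classical in
theorem weightedDist_sq {C : PreAbstractSimplicialComplex V} {m : Finset V → ℝ}
    (hm : ∀ c : C.vertices, 0 < m {(c : V)}) (g g' : C.vertices → Y) :
    C.weightedDist m g g' ^ 2 = ∑ c : C.vertices, m {(c : V)} * dist (g c) (g' c) ^ 2 :=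
  Real.sq_sqrt (Finset.sum_nonneg fun c _ => mul_nonneg (hm c).le (sq_nonneg _))

/-- In a complete geodesic CAT(0) space, every map on the vertices of a non-empty complex with
positive weights has a barycenter. -/
theorem exists_isBarycenter [Nonempty Y] [CompleteSpace Y] (hgeod : IsGeodesicSpace Y)
    (hcat : IsCAT0 Y) {C : PreAbstractSimplicialComplex V} {m : Finset V → ℝ}
    (hm : ∀ c : C.vertices, 0 < m {(c : V)}) (hC : Nonempty C.vertices) (g : C.vertices → Y) :
    ∃ b, C.IsBarycenter m g b := by
  classical
  unfold IsBarycenter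
  simp only [weightedDist_sq hm]
  have hM : 0 < ∑ c : C.vertices, m {(c : V)} :=
    Finset.sum_pos (fun c _ => hm c) Finset.univ_nonempty
  refine exists_forall_le_of_midpoint_convex
    (φ := fun y => ∑ c : C.vertices, m {(c : V)} * dist (g c) y ^ 2)
    (M := (1 / 4) * ∑ c : C.vertices, m {(c : V)}) (by fun_prop)
    (fun y => Finset.sum_nonneg fun c _ => mul_nonneg (hm c).le (sq_nonneg _))
    (by positivity) fun x y => ?_
  obtain ⟨z, hz⟩ := hcat.exists_point_dist_sq_le hgeod x y (s := 1 / 2) (by norm_num)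
    (by norm_num)
  refine ⟨z, (Finset.sum_le_sum fun c _ =>
    mul_le_mul_of_nonneg_left (hz (g c)) (hm c).le).trans_eq ?_⟩
  rw [← Finset.sum_add_distrib, Finset.sum_div, Finset.mul_sum, Finset.sum_mul,
    ← Finset.sum_sub_distrib]
  exact Finset.sum_congr rfl fun c _ => by ring

end PreAbstractSimplicialComplex

/-! ### The twisted energy and the local-to-global estimate -/

namespace PreAbstractSimplicialComplex

section TwistedEnergy

variable {V Y : Type*} [MetricSpace Y]

open Classical in
/-- The isometries attached to the edges compose along the boundaries of the simplices; the
vertices `v`, `w`, `u` need not be distinct. -/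
def IsCocycle (Z : PreAbstractSimplicialComplex V) (φ : V → V → Y ≃ᵢ Y) : Prop :=
  ∀ v w u, ({v, w, u} : Finset V) ∈ Z.faces → φ v w * φ w u = φ v u

section Cocycle

variable {Z : PreAbstractSimplicialComplex V} {φ : V → V → Y ≃ᵢ Y}

open Classical in
theorem IsCocycle.self (hφ : Z.IsCocycle φ) {v : V} (hv : v ∈ Z.vertices) : φ v v = 1 := by
  have h := hφ v v v (by simpa [vertices] using hv)
  exact mul_eq_left.mp h

open Classical in
theorem IsCocycle.dist_comm (hφ : Z.IsCocycle φ) {v w : V} (h : ({v, w} : Finset V) ∈ Z.faces)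
    (y z : Y) : dist y (φ v w z) = dist z (φ w v y) := by
  have hv : v ∈ Z.vertices :=
    (Z.isRelLowerSet_faces h).2 (by simp) (Finset.singleton_nonempty _)
  have h1 : φ v w * φ w v = 1 := by
    rw [hφ v w v (by convert h using 1; ext; simp; tauto), hφ.self hv]
  have h2 : φ v w (φ w v y) = y := by rw [← IsometryEquiv.mul_apply, h1]; rfl
  conv_lhs => rw [← h2]
  rw [(φ v w).dist_eq, _root_.dist_comm]

open Classical in
theorem IsCocycle.dist_apply_apply (hφ : Z.IsCocycle φ) {x v w : V}
    (h : ({x, v, w} : Finset V) ∈ Z.faces) (y z : Y) :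
    dist (φ x v y) (φ x w z) = dist y (φ v w z) := by
  rw [← hφ x v w h, IsometryEquiv.mul_apply, (φ x v).dist_eq]

end Cocycle

open Classical in
/-- The weight of the edge `{x, c}`, and `0` if `x` and `c` are not adjacent. -/
noncomputable def edgeWeight (Z : PreAbstractSimplicialComplex V) (m : Finset V → ℝ) (x c : V) :
    ℝ :=
  if x ≠ c ∧ ({x, c} : Finset V) ∈ Z.faces then m {x, c} else 0

open Classical in
theorem mem_faces_of_edgeWeight_ne_zero {Z : PreAbstractSimplicialComplex V} {m : Finset V → ℝ}
    {x c : V} (h : Z.edgeWeight m x c ≠ 0) : ({x, c} : Finset V) ∈ Z.faces := by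
  unfold edgeWeight at h
  by_contra h'
  exact h (if_neg fun hc => h' hc.2)

theorem edgeWeight_comm (Z : PreAbstractSimplicialComplex V) (m : Finset V → ℝ) (x c : V) :
    Z.edgeWeight m x c = Z.edgeWeight m c x := by
  classical
  simp only [edgeWeight, Finset.pair_comm x c, ne_comm (a := x)]

variable [Fintype V]

theorem IsWeight.edgeWeight_nonneg {Z : PreAbstractSimplicialComplex V} {m : Finset V → ℝ}
    (hm : Z.IsWeight m) (x c : V) : 0 ≤ Z.edgeWeight m x c := by
  unfold edgeWeight
  split_ifs with h
  · exact (hm.pos _ h.2).le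
  · exact le_rfl

open Classical in
/-- The triangles over an edge weigh at most as much as the edge: if there is no such triangle,
the sum is empty, and otherwise the two sides agree. -/
theorem IsWeight.sum_triangle_le {Z : PreAbstractSimplicialComplex V} {m : Finset V → ℝ}
    (hm : Z.IsWeight m) (c c' : V) :
    (∑ x, if c ≠ c' ∧ x ∉ ({c, c'} : Finset V) ∧ insert x ({c, c'} : Finset V) ∈ Z.faces then
      m (insert x {c, c'}) else 0) ≤ Z.edgeWeight m c c' := by
  rw [← Finset.sum_filter]
  set s : Finset V := {c, c'} with hs
  set A := Finset.univ.filter fun x => c ≠ c' ∧ x ∉ s ∧ insert x s ∈ Z.faces with hA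
  rcases A.eq_empty_or_nonempty with hAe | ⟨x, hx⟩
  · rw [hAe, Finset.sum_empty]
    exact hm.edgeWeight_nonneg c c'
  obtain ⟨hne, hxs, hxf⟩ := (Finset.mem_filter.mp hx).2
  have hsf : s ∈ Z.faces :=
    Z.isRelLowerSet_faces hxf |>.2 (Finset.subset_insert x s) (Finset.insert_nonempty _ _)
  rw [edgeWeight, if_pos ⟨hne, hsf⟩, hm.eq_sum s hsf ⟨_, hxf, Finset.ssubset_insert hxs⟩]
  have hinj : Set.InjOn (fun x => insert x s) A := by
    intro y hy z _ hyz
    have hys := (Finset.mem_filter.mp hy).2.2.1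
    have : y ∈ insert z s := by
      have h : y ∈ insert y s := Finset.mem_insert_self y s
      rwa [show insert y s = insert z s from hyz] at h
    exact (Finset.mem_insert.mp this).resolve_right hys
  rw [← Finset.sum_image (f := m) hinj]
  refine Finset.sum_le_sum_of_subset_of_nonneg ?_ fun t ht _ =>
    (hm.pos t (Finset.mem_filter.mp ht).2.1).le
  intro t ht
  obtain ⟨y, hy, rfl⟩ := Finset.mem_image.mp ht
  obtain ⟨-, hys, hyf⟩ := (Finset.mem_filter.mp hy).2
  exact Finset.mem_filter.mpr ⟨Finset.mem_univ _, hyf, Finset.subset_insert y s,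
    Finset.card_insert_of_notMem hys⟩

open Classical in
theorem sum_vertices (C : PreAbstractSimplicialComplex V) (F : V → ℝ) :
    ∑ c : C.vertices, F c = ∑ c, if c ∈ C.vertices then F c else 0 := by
  rw [← Finset.sum_filter]
  exact (Finset.sum_subtype _ (by simp) F).symm

open Classical in
theorem energy_restrict (C : PreAbstractSimplicialComplex V) (m : Finset V → ℝ) (G : V → Y) :
    C.energy m (fun c => G c) = (1 / 2) * ∑ c, ∑ c',
      if c ≠ c' ∧ ({c, c'} : Finset V) ∈ C.faces then
        m {c, c'} * dist (G c) (G c') ^ 2 else 0 := by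
  have hv : ∀ {c c' : V}, ({c, c'} : Finset V) ∈ C.faces → c ∈ C.vertices ∧ c' ∈ C.vertices :=
    fun {c c'} h => ⟨(C.isRelLowerSet_faces h).2 (by simp) (Finset.singleton_nonempty _),
      (C.isRelLowerSet_faces h).2 (by simp) (Finset.singleton_nonempty _)⟩
  unfold energy
  congr 1
  simp only [ne_eq, ← Subtype.coe_inj]
  rw [C.sum_vertices fun c => ∑ c' : C.vertices,
    if ¬c = (c' : V) ∧ ({c, (c' : V)} : Finset V) ∈ C.faces then
      m {c, (c' : V)} * dist (G c) (G c') ^ 2 else 0]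
  refine Finset.sum_congr rfl fun c _ => ?_
  rw [C.sum_vertices fun c' => if ¬c = c' ∧ ({c, c'} : Finset V) ∈ C.faces then
      m {c, c'} * dist (G c) (G c') ^ 2 else 0]
  split_ifs with hc
  · refine Finset.sum_congr rfl fun c' _ => ?_
    split_ifs with h1 h2 h2
    · rfl
    · rfl
    · exact absurd (hv h2.2).2 h1
    · rfl
  · refine (Finset.sum_eq_zero fun c' _ => if_neg fun h => hc (hv h.2).1).symm

theorem mem_link_vertices {Z : PreAbstractSimplicialComplex V} {m : Finset V → ℝ}
    (hm : Z.IsWeight m) {x c : V} : c ∈ (Z.link x).vertices ↔ 0 < Z.edgeWeight m x c := by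
  classical
  have h : c ∈ (Z.link x).vertices ↔ x ≠ c ∧ ({x, c} : Finset V) ∈ Z.faces := by
    simp [vertices, link]
  rw [h]
  unfold edgeWeight
  constructor
  · intro h'
    have := hm.pos _ h'.2
    simp only [h'.1, ne_eq, not_false_eq_true, true_and]
    convert this using 1
    exact if_pos h'.2
  · intro h'
    by_contra hn
    rw [if_neg (by convert hn)] at h'
    exact lt_irrefl _ h'

/-- The energy pairing of two maps `f` and `g` which are twisted by the isometries `φ`: the sum of
`m(x, c) d(f(x), φ_{x, c} g(c))²` over the ordered pairs of adjacent vertices. If `φ` is the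
holonomy of an action of the fundamental group, the maps from the vertices correspond to the
equivariant maps from the vertices of the universal cover, and the pairing of `f` with itself is
twice the energy of the equivariant map. -/
noncomputable def twistedEnergy (Z : PreAbstractSimplicialComplex V) (m : Finset V → ℝ)
    (φ : V → V → Y ≃ᵢ Y) (f g : V → Y) : ℝ :=
  ∑ x, ∑ c, Z.edgeWeight m x c * dist (f x) (φ x c (g c)) ^ 2

section Pairing

variable {Z : PreAbstractSimplicialComplex V} {m : Finset V → ℝ} {φ : V → V → Y ≃ᵢ Y}

theorem twistedEnergy_nonneg (hm : Z.IsWeight m) (f g : V → Y) : 0 ≤ Z.twistedEnergy m φ f g :=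
  Finset.sum_nonneg fun x _ => Finset.sum_nonneg fun c _ =>
    mul_nonneg (hm.edgeWeight_nonneg x c) (sq_nonneg _)

theorem twistedEnergy_comm (hφ : Z.IsCocycle φ) (f g : V → Y) :
    Z.twistedEnergy m φ f g = Z.twistedEnergy m φ g f := by
  unfold twistedEnergy
  rw [Finset.sum_comm]
  refine Finset.sum_congr rfl fun c _ => Finset.sum_congr rfl fun x _ => ?_
  rw [edgeWeight_comm]
  by_cases h : Z.edgeWeight m c x = 0
  · rw [h, zero_mul, zero_mul]
  · rw [← hφ.dist_comm (mem_faces_of_edgeWeight_ne_zero h)]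

theorem twistedEnergy_le_of_dist_sq_le (hm : Z.IsWeight m) {f g h : V → Y} {t : ℝ}
    (hh : ∀ x p, dist p (h x) ^ 2 ≤ (1 - t) * dist p (f x) ^ 2 + t * dist p (g x) ^ 2)
    (k : V → Y) :
    Z.twistedEnergy m φ h k ≤
      (1 - t) * Z.twistedEnergy m φ f k + t * Z.twistedEnergy m φ g k := by
  unfold twistedEnergy
  rw [Finset.mul_sum, Finset.mul_sum, ← Finset.sum_add_distrib]
  refine Finset.sum_le_sum fun x _ => ?_
  rw [Finset.mul_sum, Finset.mul_sum, ← Finset.sum_add_distrib]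
  refine Finset.sum_le_sum fun c _ => ?_
  have := mul_le_mul_of_nonneg_left (hh x (φ x c (k c))) (hm.edgeWeight_nonneg x c)
  rw [dist_comm (h x), dist_comm (f x), dist_comm (g x)]
  linarith

theorem twistedEnergy_self_le (hm : Z.IsWeight m) (hφ : Z.IsCocycle φ) (f g : V → Y) :
    Z.twistedEnergy m φ g g ≤ 3 * (2 * Z.twistedEnergy m φ g f + Z.twistedEnergy m φ f f) := by
  have h : Z.twistedEnergy m φ g g ≤ 3 * (Z.twistedEnergy m φ g f + Z.twistedEnergy m φ f f +
      Z.twistedEnergy m φ f g) := by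
    unfold twistedEnergy
    rw [← Finset.sum_add_distrib, ← Finset.sum_add_distrib, Finset.mul_sum]
    refine Finset.sum_le_sum fun x _ => ?_
    rw [← Finset.sum_add_distrib, ← Finset.sum_add_distrib, Finset.mul_sum]
    refine Finset.sum_le_sum fun c _ => ?_
    have htri := dist_triangle4 (g x) (φ x c (f c)) (f x) (φ x c (g c))
    rw [dist_comm (φ x c (f c)) (f x)] at htri
    have hsq : dist (g x) (φ x c (g c)) ^ 2 ≤ 3 * (dist (g x) (φ x c (f c)) ^ 2 +
        dist (f x) (φ x c (f c)) ^ 2 + dist (f x) (φ x c (g c)) ^ 2) := by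
      have h1 := pow_le_pow_left₀ dist_nonneg htri 2
      nlinarith [sq_nonneg (dist (g x) (φ x c (f c)) - dist (f x) (φ x c (f c))),
        sq_nonneg (dist (g x) (φ x c (f c)) - dist (f x) (φ x c (g c))),
        sq_nonneg (dist (f x) (φ x c (f c)) - dist (f x) (φ x c (g c)))]
    have := mul_le_mul_of_nonneg_left hsq (hm.edgeWeight_nonneg x c)
    linarith
  rw [twistedEnergy_comm hφ f g] at h
  linarith

/-- The energies of a twisted map on the links add up to at most its total energy: an edge is seen
in the links of the vertices opposite to it, once for every triangle that contains it. -/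
theorem sum_energy_link_le (hm : Z.IsWeight m) (hφ : Z.IsCocycle φ) (f : V → Y) :
    ∑ x, (Z.link x).energy (linkWeight m x) (fun c => φ x c (f c)) ≤
      (1 / 2) * Z.twistedEnergy m φ f f := by
  classical
  have hx : ∀ x, (Z.link x).energy (linkWeight m x) (fun c => φ x c (f c)) =
      (1 / 2) * ∑ c, ∑ c', (if c ≠ c' ∧ x ∉ ({c, c'} : Finset V) ∧
        insert x ({c, c'} : Finset V) ∈ Z.faces then m (insert x {c, c'}) else 0) *
          dist (f c) (φ c c' (f c')) ^ 2 := by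
    intro x
    rw [energy_restrict (Z.link x) (linkWeight m x) (fun c => φ x c (f c))]
    congr 1
    refine Finset.sum_congr rfl fun c _ => Finset.sum_congr rfl fun c' _ => ?_
    by_cases h : c ≠ c' ∧ x ∉ ({c, c'} : Finset V) ∧ insert x ({c, c'} : Finset V) ∈ Z.faces
    · rw [if_pos h, if_pos]
      · rw [hφ.dist_apply_apply (by convert h.2.2)]
        simp only [linkWeight]
      · refine ⟨h.1, ?_⟩
        simp only [link, Set.mem_ofPred_eq]
        refine ⟨Finset.insert_nonempty _ _, ?_, ?_⟩
        · convert h.2.1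
        · convert h.2.2
    · rw [if_neg h, if_neg, zero_mul]
      intro h'
      apply h
      obtain ⟨h1, h2⟩ := h'
      simp only [link, Set.mem_ofPred_eq] at h2
      refine ⟨h1, ?_, ?_⟩
      · convert h2.2.1
      · convert h2.2.2
  simp only [hx]
  rw [← Finset.mul_sum, Finset.sum_comm]
  refine mul_le_mul_of_nonneg_left (Finset.sum_le_sum fun c _ => ?_) (by norm_num)
  rw [Finset.sum_comm]
  refine Finset.sum_le_sum fun c' _ => ?_
  rw [← Finset.sum_mul]
  refine mul_le_mul_of_nonneg_right ?_ (sq_nonneg _)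
  convert hm.sum_triangle_le c c'

theorem energy_nonneg {C : PreAbstractSimplicialComplex V} {m : Finset V → ℝ}
    (hm : ∀ s ∈ C.faces, 0 < m s) (g : C.vertices → Y) : 0 ≤ C.energy m g := by
  classical
  unfold energy
  refine mul_nonneg (by norm_num) (Finset.sum_nonneg fun c _ => Finset.sum_nonneg fun c' _ => ?_)
  split_ifs with h
  · exact mul_nonneg (hm _ h.2).le (sq_nonneg _)
  · exact le_rfl

/-- A real lower bound for the bottom of the spectrum bounds the energy from below, also for the
constant maps. -/
theorem mul_weightedDist_sq_le_energy {C : PreAbstractSimplicialComplex V} {m : Finset V → ℝ}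
    (hm : ∀ s ∈ C.faces, 0 < m s) {l : ℝ} (hl : (l : EReal) ≤ C.bottomSpectrum m Y)
    {g : C.vertices → Y} {b : Y} (hb : C.IsBarycenter m g b) :
    l * C.weightedDist m g (fun _ => b) ^ 2 ≤ C.energy m g := by
  rcases (sq_nonneg (C.weightedDist m g fun _ => b)).eq_or_lt with h0 | h0
  · rw [← h0, mul_zero]
    exact energy_nonneg hm g
  have hne : ¬ ∃ y : Y, ∀ c, g c = y := by
    rintro ⟨y, hy⟩
    have h1 := hb y
    have h2 : C.weightedDist m g (fun _ => y) = 0 := by simp [weightedDist, hy]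
    rw [h2] at h1
    norm_num at h1
    rw [h1] at h0
    norm_num at h0
  have h := hl.trans (iInf_le_of_le g (iInf_le_of_le b (iInf_le_of_le hne (iInf_le_of_le hb
    le_rfl))))
  rw [EReal.coe_le_coe_iff, rayleighQuotient, le_div_iff₀ h0] at h
  exact h

theorem link_pos (hm : Z.IsWeight m) (x : V) : ∀ s ∈ (Z.link x).faces, 0 < linkWeight m x s :=
  fun _ hs => hm.pos _ hs.2.2

/-- At every vertex `x` there is a point at which the spectral gap of the link is effective for
the values of a twisted map around `x`. It is the barycenter, unless `x` has no neighbour. -/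
theorem exists_point_of_link_spectrum [Nonempty Y] [CompleteSpace Y]
    (hgeod : IsGeodesicSpace Y) (hcat : IsCAT0 Y) (hm : Z.IsWeight m) {l : ℝ}
    (hl : ∀ z ∈ Z.vertices, (l : EReal) ≤ (Z.link z).bottomSpectrum (linkWeight m z) Y)
    (f : V → Y) (x : V) :
    ∃ b : Y, l * ∑ c, Z.edgeWeight m x c * dist b (φ x c (f c)) ^ 2 ≤
        (Z.link x).energy (linkWeight m x) (fun c => φ x c (f c)) ∧
      ((∀ c, Z.edgeWeight m x c = 0) → b = f x) := by
  classical
  by_cases hx : ∀ c, Z.edgeWeight m x c = 0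
  · refine ⟨f x, ?_, fun _ => rfl⟩
    simp only [hx, zero_mul, Finset.sum_const_zero, mul_zero]
    exact energy_nonneg (link_pos hm x) _
  push Not at hx
  obtain ⟨c₀, hc₀⟩ := hx
  have hpos : ∀ c : (Z.link x).vertices, 0 < linkWeight m x {(c : V)} :=
    fun c => link_pos hm x _ c.2
  have hne : Nonempty (Z.link x).vertices :=
    ⟨⟨c₀, (mem_link_vertices hm).mpr ((hm.edgeWeight_nonneg x c₀).lt_of_ne' hc₀)⟩⟩
  have hxv : x ∈ Z.vertices := by
    have := mem_faces_of_edgeWeight_ne_zero hc₀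
    exact (Z.isRelLowerSet_faces this).2 (by simp) (Finset.singleton_nonempty _)
  obtain ⟨b, hb⟩ := exists_isBarycenter hgeod hcat hpos hne (fun c => φ x c (f c))
  refine ⟨b, ?_, fun h => absurd (h c₀) hc₀⟩
  have h := mul_weightedDist_sq_le_energy (link_pos hm x) (hl x hxv) hb
  rw [weightedDist_sq hpos, (Z.link x).sum_vertices fun c =>
    linkWeight m x {c} * dist (φ x c (f c)) b ^ 2] at h
  convert h using 3 with c
  by_cases hc : c ∈ (Z.link x).vertices
  · rw [if_pos hc, dist_comm]
    congr 1
    have h0 := (mem_link_vertices hm).mp hc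
    unfold edgeWeight at h0 ⊢
    split_ifs at h0 ⊢ with h'
    · simp only [linkWeight]
    · exact absurd h0 (lt_irrefl _)
  · rw [if_neg hc]
    have : Z.edgeWeight m x c = 0 := by
      by_contra h'
      exact hc ((mem_link_vertices hm).mpr ((hm.edgeWeight_nonneg x c).lt_of_ne' h'))
    rw [this, zero_mul]

/-- Averaging over the links: there is `g` whose pairing with `f` is strictly smaller than the
pairing of `f` with itself, by a factor that does not depend on `f`. -/
theorem exists_twistedEnergy_le [Nonempty Y] [CompleteSpace Y]
    (hgeod : IsGeodesicSpace Y) (hcat : IsCAT0 Y) (hm : Z.IsWeight m) (hφ : Z.IsCocycle φ) {l : ℝ}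
    (hl : ∀ z ∈ Z.vertices, (l : EReal) ≤ (Z.link z).bottomSpectrum (linkWeight m z) Y)
    (f : V → Y) :
    ∃ g : V → Y, 2 * l * Z.twistedEnergy m φ g f ≤ Z.twistedEnergy m φ f f ∧
      ∀ x, (∀ c, Z.edgeWeight m x c = 0) → g x = f x := by
  choose g hg hg0 using exists_point_of_link_spectrum (φ := φ) hgeod hcat hm hl f
  refine ⟨g, ?_, hg0⟩
  have h := (Finset.sum_le_sum fun x (_ : x ∈ Finset.univ) => hg x).trans
    (sum_energy_link_le hm hφ f)
  rw [← Finset.mul_sum] at h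
  change l * Z.twistedEnergy m φ g f ≤ _ at h
  linarith

theorem edgeWeight_mul_dist_sq_le (hm : Z.IsWeight m) (f g : V → Y) (x c : V) :
    Z.edgeWeight m x c * dist (f x) (g x) ^ 2 ≤
      2 * (Z.twistedEnergy m φ f f + Z.twistedEnergy m φ g f) := by
  have hterm : ∀ k : V → Y, Z.edgeWeight m x c * dist (k x) (φ x c (f c)) ^ 2 ≤
      Z.twistedEnergy m φ k f := by
    intro k
    have hnn : ∀ x c, 0 ≤ Z.edgeWeight m x c * dist (k x) (φ x c (f c)) ^ 2 :=
      fun x c => mul_nonneg (hm.edgeWeight_nonneg x c) (sq_nonneg _)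
    exact (Finset.single_le_sum (f := fun c => Z.edgeWeight m x c *
      dist (k x) (φ x c (f c)) ^ 2) (fun c _ => hnn x c) (Finset.mem_univ c)).trans
      (Finset.single_le_sum (f := fun x => ∑ c, Z.edgeWeight m x c *
        dist (k x) (φ x c (f c)) ^ 2) (fun x _ => Finset.sum_nonneg fun c _ => hnn x c)
        (Finset.mem_univ x))
  have hsq : dist (f x) (g x) ^ 2 ≤
      2 * (dist (f x) (φ x c (f c)) ^ 2 + dist (g x) (φ x c (f c)) ^ 2) := by
    have h1 := pow_le_pow_left₀ dist_nonneg
      (dist_triangle_right (f x) (g x) (φ x c (f c))) 2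
    nlinarith [sq_nonneg (dist (f x) (φ x c (f c)) - dist (g x) (φ x c (f c)))]
  have h2 := mul_le_mul_of_nonneg_left hsq (hm.edgeWeight_nonneg x c)
  linarith [hterm f, hterm g]

/-- One step of the descent. Moving every value `f(x)` a fixed small proportion of the way to the
barycenter of `f` on the link of `x` decreases the energy by a fixed factor, and the displacement
is controlled by the energy. -/
theorem exists_twistedEnergy_contraction [Nonempty Y] [CompleteSpace Y]
    (hgeod : IsGeodesicSpace Y) (hcat : IsCAT0 Y) (hm : Z.IsWeight m) (hφ : Z.IsCocycle φ) {l : ℝ}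
    (hl2 : 1 / 2 < l)
    (hl : ∀ z ∈ Z.vertices, (l : EReal) ≤ (Z.link z).bottomSpectrum (linkWeight m z) Y) :
    ∃ κ C : ℝ, 0 ≤ κ ∧ κ < 1 ∧ 0 ≤ C ∧ ∀ f : V → Y, ∃ h : V → Y,
      Z.twistedEnergy m φ h h ≤ κ * Z.twistedEnergy m φ f f ∧
      ∀ x, dist (f x) (h x) ^ 2 ≤ C * Z.twistedEnergy m φ f f := by
  set θ : ℝ := 1 / (2 * l) with hθ
  have hl0 : 0 < 2 * l := by linarith
  have hθ0 : 0 < θ := by positivity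
  have hθ1 : θ < 1 := by rw [hθ, div_lt_one hl0]; linarith
  -- The factor `(1 - t)² + 2 t (1 - t) θ + 9 t²` is at most `1 - 2 t (1 - θ) + 10 t²`, which is
  -- smallest at this `t`.
  set t : ℝ := (1 - θ) / 10 with ht
  have ht0 : 0 ≤ t := by rw [ht]; linarith
  have ht1 : t ≤ 1 := by rw [ht]; linarith
  have hinv : ∀ x c, 0 ≤ (Z.edgeWeight m x c)⁻¹ := fun x c =>
    inv_nonneg.mpr (hm.edgeWeight_nonneg x c)
  refine ⟨1 - (1 - θ) ^ 2 / 10, ∑ x, ∑ c, 4 * (Z.edgeWeight m x c)⁻¹, by nlinarith, by nlinarith,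
    Finset.sum_nonneg fun x _ => Finset.sum_nonneg fun c _ => mul_nonneg (by norm_num) (hinv x c),
    fun f => ?_⟩
  obtain ⟨g, hg, hg0⟩ := exists_twistedEnergy_le hgeod hcat hm hφ hl f
  choose h hh using fun x => hcat.exists_point_dist_sq_le hgeod (f x) (g x) ht0 ht1
  have hconv : ∀ x p, dist p (h x) ^ 2 ≤ (1 - t) * dist p (f x) ^ 2 + t * dist p (g x) ^ 2 :=
    fun x p => by
      have h1 := hh x p
      have h2 : 0 ≤ t * (1 - t) * dist (f x) (g x) ^ 2 :=
        mul_nonneg (mul_nonneg ht0 (by linarith)) (sq_nonneg _)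
      linarith
  set Q := Z.twistedEnergy m φ f f with hQ
  have hQ0 : 0 ≤ Q := twistedEnergy_nonneg hm f f
  have hgf : Z.twistedEnergy m φ g f ≤ θ * Q := by
    rw [hθ, div_mul_eq_mul_div, one_mul, le_div_iff₀ hl0]
    linarith
  have hgfQ : Z.twistedEnergy m φ g f ≤ Q := by nlinarith
  refine ⟨h, ?_, fun x => ?_⟩
  · have hgg : Z.twistedEnergy m φ g g ≤ 9 * Q := by
      have := twistedEnergy_self_le hm hφ f g
      linarith
    have h1 := twistedEnergy_le_of_dist_sq_le (φ := φ) hm hconv h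
    have h2 := twistedEnergy_le_of_dist_sq_le (φ := φ) hm hconv f
    have h3 := twistedEnergy_le_of_dist_sq_le (φ := φ) hm hconv g
    rw [twistedEnergy_comm hφ h f] at h2
    rw [twistedEnergy_comm hφ h g, twistedEnergy_comm hφ f g] at h3
    have ht1' : 0 ≤ 1 - t := by linarith
    calc Z.twistedEnergy m φ h h
        ≤ (1 - t) * ((1 - t) * Q + t * Z.twistedEnergy m φ g f) +
          t * ((1 - t) * Z.twistedEnergy m φ g f + t * Z.twistedEnergy m φ g g) :=
          h1.trans (by gcongr)
      _ ≤ (1 - t) * ((1 - t) * Q + t * (θ * Q)) +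
          t * ((1 - t) * (θ * Q) + t * (9 * Q)) := by gcongr
      _ = (1 - 2 * t * (1 - θ) + t ^ 2 * (10 - 2 * θ)) * Q := by ring
      _ ≤ (1 - (1 - θ) ^ 2 / 10) * Q := by
          refine mul_le_mul_of_nonneg_right ?_ hQ0
          rw [ht]
          nlinarith [mul_nonneg hθ0.le (sq_nonneg (1 - θ))]
  · by_cases hx : ∀ c, Z.edgeWeight m x c = 0
    · have h1 := hconv x (f x)
      rw [hg0 x hx, dist_self] at h1
      have h2 : 0 ≤ (∑ x, ∑ c, 4 * (Z.edgeWeight m x c)⁻¹) * Q := mul_nonneg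
        (Finset.sum_nonneg fun x _ => Finset.sum_nonneg fun c _ =>
          mul_nonneg (by norm_num) (hinv x c)) hQ0
      linarith
    · push Not at hx
      obtain ⟨c, hc⟩ := hx
      have hc' : 0 < Z.edgeWeight m x c := (hm.edgeWeight_nonneg x c).lt_of_ne' hc
      have h1 : dist (f x) (h x) ^ 2 ≤ dist (f x) (g x) ^ 2 := by
        have := hconv x (f x)
        rw [dist_self] at this
        nlinarith [sq_nonneg (dist (f x) (g x))]
      have h2 := edgeWeight_mul_dist_sq_le (φ := φ) hm f g x c
      have h3 : dist (f x) (g x) ^ 2 ≤ 4 * (Z.edgeWeight m x c)⁻¹ * Q := by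
        rw [← mul_le_mul_iff_right₀ hc']
        calc _ ≤ 4 * Q := by linarith
          _ = _ := by field_simp
      refine h1.trans (h3.trans (mul_le_mul_of_nonneg_right ?_ hQ0))
      have hnn : ∀ x c, 0 ≤ 4 * (Z.edgeWeight m x c)⁻¹ :=
        fun x c => mul_nonneg (by norm_num) (hinv x c)
      exact (Finset.single_le_sum (f := fun c => 4 * (Z.edgeWeight m x c)⁻¹)
        (fun c _ => hnn x c) (Finset.mem_univ c)).trans
        (Finset.single_le_sum (f := fun x => ∑ c, 4 * (Z.edgeWeight m x c)⁻¹)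
          (fun x _ => Finset.sum_nonneg fun c _ => hnn x c) (Finset.mem_univ x))

open Classical in
/-- If the spectra of all links have a common lower bound above `1 / 2`, there is a twisted map of
energy zero: the descent converges, at a geometric rate. -/
theorem exists_flat_of_link_spectrum [Nonempty Y] [CompleteSpace Y]
    (hgeod : IsGeodesicSpace Y) (hcat : IsCAT0 Y) (hm : Z.IsWeight m) (hφ : Z.IsCocycle φ) {l : ℝ}
    (hl2 : 1 / 2 < l)
    (hl : ∀ z ∈ Z.vertices, (l : EReal) ≤ (Z.link z).bottomSpectrum (linkWeight m z) Y) :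
    ∃ f : V → Y, ∀ v w, ({v, w} : Finset V) ∈ Z.faces → φ v w (f w) = f v := by
  obtain ⟨κ, C, hκ0, hκ1, hC, hstep⟩ :=
    exists_twistedEnergy_contraction hgeod hcat hm hφ hl2 hl
  choose S hS hSd using hstep
  let F : ℕ → V → Y := fun n => S^[n] fun _ => Classical.arbitrary Y
  have hF : ∀ n, F (n + 1) = S (F n) := fun n => Function.iterate_succ_apply' S n _
  set Q := fun f => Z.twistedEnergy m φ f f with hQ
  have hQ0 : ∀ f, 0 ≤ Q f := fun f => twistedEnergy_nonneg hm f f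
  have hen : ∀ n, Q (F n) ≤ κ ^ n * Q (F 0) := by
    intro n
    induction n with
    | zero => simp
    | succ n ih =>
      rw [hF, pow_succ']
      have h1 : Q (S (F n)) ≤ κ * Q (F n) := hS (F n)
      have h2 := mul_le_mul_of_nonneg_left ih hκ0
      linarith
  have hlim : ∀ x, ∃ y, Filter.Tendsto (fun n => F n x) Filter.atTop (nhds y) := by
    intro x
    refine cauchySeq_tendsto_of_complete
      (cauchySeq_of_le_geometric (√κ) (√(C * Q (F 0))) ?_ fun n => ?_)
    · rw [Real.sqrt_lt' one_pos]
      simpa using hκ1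
    · have h1 := hSd (F n) x
      rw [← hF] at h1
      refine le_of_sq_le_sq (h1.trans ?_) (by positivity)
      rw [mul_pow, ← pow_mul, mul_comm n 2, pow_mul, Real.sq_sqrt hκ0,
        Real.sq_sqrt (mul_nonneg hC (hQ0 _))]
      have := mul_le_mul_of_nonneg_left (hen n) hC
      linarith
  choose f hf using hlim
  have hQf : Q f = 0 := by
    refine le_antisymm (le_of_tendsto_of_tendsto' (b := Filter.atTop) (f := fun n => Q (F n)) ?_ ?_ hen) (hQ0 f)
    · simp only [hQ, twistedEnergy]
      refine tendsto_finsetSum _ fun x _ => tendsto_finsetSum _ fun c _ => ?_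
      exact (((hf x).dist (((φ x c).continuous.tendsto _).comp (hf c))).pow 2).const_mul _
    · simpa using (tendsto_pow_atTop_nhds_zero_of_lt_one hκ0 hκ1).mul_const (Q (F 0))
  refine ⟨f, fun v w hvw => ?_⟩
  rcases eq_or_ne v w with rfl | hne
  · rw [hφ.self (by simpa [vertices] using hvw)]
    rfl
  have hnn : ∀ x c, 0 ≤ Z.edgeWeight m x c * dist (f x) (φ x c (f c)) ^ 2 :=
    fun x c => mul_nonneg (hm.edgeWeight_nonneg x c) (sq_nonneg _)
  have h1 := (Finset.sum_eq_zero_iff_of_nonneg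
    fun x _ => Finset.sum_nonneg fun c _ => hnn x c).mp hQf v (Finset.mem_univ v)
  have h2 := (Finset.sum_eq_zero_iff_of_nonneg fun c _ => hnn v c).mp h1 w (Finset.mem_univ w)
  have h3 : Z.edgeWeight m v w = m {v, w} := if_pos ⟨hne, hvw⟩
  rw [h3] at h2
  have h4 := (mul_eq_zero.mp h2).resolve_left (hm.pos _ hvw).ne'
  exact (dist_eq_zero.mp (pow_eq_zero_iff two_ne_zero |>.mp h4)).symm

end Pairing

end TwistedEnergy

end PreAbstractSimplicialComplex

/-! ### The fixed point theorem -/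

namespace PreAbstractSimplicialComplex

open Classical in
/-- The transport along the edges of a complex is a cocycle, since it extends to the simplices. -/
theorem isCocycle_alongSegment {V Y : Type*} [Fintype V] [MetricSpace Y]
    (Z : PreAbstractSimplicialComplex V) (Φ : PathTransport Z.realization (Y ≃ᵢ Y)) :
    Z.IsCocycle fun v w => Φ.alongSegment (Pi.single v 1) (Pi.single w 1) :=
  fun _ _ _ h => Φ.alongSegment_mul_alongSegment (Z.closedSimplex_subset_realization h)
    (convex_closedSimplex _) (single_mem_closedSimplex (by simp))
    (single_mem_closedSimplex (by simp)) (single_mem_closedSimplex (by simp))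

end PreAbstractSimplicialComplex

theorem mainTheorem5 {V : Type*} [Fintype V]
    (Z : PreAbstractSimplicialComplex V) (m : Finset V → ℝ) (hm : Z.IsWeight m)
    (x₀ : Z.realization)
    {Γ : Type*} [Group Γ] (e : Γ ≃* FundamentalGroup Z.realization x₀)
    {Y : Type*} [MetricSpace Y] [Nonempty Y] [CompleteSpace Y]
    (hgeod : IsGeodesicSpace Y) (hcat : IsCAT0 Y)
    (hspec : ∀ z ∈ Z.vertices,
      ((1 / 2 : ℝ) : EReal) <
        (Z.link z).bottomSpectrum (PreAbstractSimplicialComplex.linkWeight m z) Y) :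
    ∀ ρ : Γ →* (Y ≃ᵢ Y), ∃ y : Y, ∀ γ : Γ, ρ γ y = y := by
  classical
  intro ρ
  -- There are finitely many links, so their spectra have a common lower bound above `1 / 2`.
  obtain ⟨l, hl2, hl⟩ : ∃ l : ℝ, 1 / 2 < l ∧ ∀ z ∈ Z.vertices, (l : EReal) ≤
      (Z.link z).bottomSpectrum (PreAbstractSimplicialComplex.linkWeight m z) Y := by
    have hr : ∀ z, ∃ r : ℝ, 1 / 2 < r ∧ (z ∈ Z.vertices → (r : EReal) ≤
        (Z.link z).bottomSpectrum (PreAbstractSimplicialComplex.linkWeight m z) Y) := by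
      intro z
      by_cases hz : z ∈ Z.vertices
      · obtain ⟨r, hr1, hr2⟩ := EReal.lt_iff_exists_real_btwn.mp (hspec z hz)
        exact ⟨r, EReal.coe_lt_coe_iff.mp hr1, fun _ => hr2.le⟩
      · exact ⟨1, by norm_num, fun h => absurd h hz⟩
    choose r hr1 hr2 using hr
    have : Nonempty V := ⟨(Z.isRelLowerSet_faces x₀.2.2).1.choose⟩
    obtain ⟨z₀, hz₀⟩ := Finite.exists_min r
    exact ⟨r z₀, hr1 z₀, fun z hz => (EReal.coe_le_coe_iff.mpr (hz₀ z)).trans (hr2 z hz)⟩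
  obtain ⟨Φ, hΦ⟩ := PathTransport.exists_of_fundamentalGroup x₀ (ρ.comp e.symm.toMonoidHom)
  obtain ⟨f, hf⟩ := PreAbstractSimplicialComplex.exists_flat_of_link_spectrum hgeod hcat hm
    (Z.isCocycle_alongSegment Φ) hl2 hl
  obtain ⟨F, hF⟩ := Z.exists_parallel_section Φ f hf
  refine ⟨F x₀, fun γ => ?_⟩
  obtain ⟨p, hp⟩ := hΦ (e γ)
  have h := hF p
  rw [hp] at h
  simpa using h
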